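/- All rings are commutative with $1$; $U(S)$ denotes the group of units of $S$, and $Um(R^2)$ the set of pairs $(a,b)\in R^2$ with $Ra+Rb=R$. A ring $R$ is a *Hermite ring* if every pair in $R^2$ has the form $(dx,dy)$ with $d\in R$ and $(x,y)\in Um(R^2)$. It is an *elementary divisor ring* (EDR) if for all integers $m,n\ge 1$ every $m\times n$ matrix $A$ with entries in $R$ admits diagonal reduction: there are $M\in GL_m(R)$ and $N\in GL_n(R)$ such that $MAN$ has zero off-diagonal entries and each of its diagonal entries divides the next one. It is a $(WSU)_2$ ring if for each $2\times 2$ matrix $A$ whose entries generate the unit ideal of $R$ there exists $N\in GL_2(R)$ such that $AN$ is symmetric. For $a,b,c\in R$ let $$\upsilon_{a,b,c}:U(R/Rac)\times U(R/Rbc)\to U(R/Rc)$$ be the homomorphism that sends a pair of units to the product of their reductions modulo $Rc$. A group is *Boolean* if the square of each of its elements is the identity; so $\mathrm{Coker}(\upsilon_{a,b,c})$ is Boolean iff $x^2\in\mathrm{Im}(\upsilon_{a,b,c})$ for all $x\in U(R/Rc)$. An $S$-module $P$ is *self-dual* if $P\cong \mathrm{Hom}_S(P,S)$. **Corollary.**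 Let $R$ be a Hermite ring such that for each $a\in R$, every self-dual projective $R/Ra$-module of (constant) rank $1$ generated by $2$ elements is free. Then the following properties hold. (1) The ring $R$ is an EDR if and only if for all $(a,b)\in Um(R^2)$ and $c\in R$, $\mathrm{Coker}(\upsilon_{a,b,c})$ is a Boolean group. (2) If $R$ is a $(WSU)_2$ ring, then $R$ is an EDR. -/

import Mathlib

namespace HermiteRings

universe u

/-- A matrix is unimodular if its entries generate the unit ideal, i.e. it is a unimodular element of
the free module of all matrices of its size. For pairs, `IsCoprime a b` says `(a, b) ∈ Um(R²)`. -/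
def IsUnimodular {R : Type u} [CommRing R] {m n : ℕ} (A : Matrix (Fin m) (Fin n) R) : Prop :=
  Ideal.span (Set.range fun p : Fin m × Fin n => A p.1 p.2) = ⊤

/-- Hermite ring in the sense of Kaplansky: `R² = R · Um(R²)`. -/
def IsHermite (R : Type u) [CommRing R] : Prop :=
  ∀ x y : R, ∃ d x' y' : R, IsCoprime x' y' ∧ x = d * x' ∧ y = d * y'

/-- `A` is equivalent to a matrix `D` whose off-diagonal entries vanish and in which each diagonal
entry divides the next one. -/
def AdmitsDiagonalReduction {R : Type u} [CommRing R] {m n : ℕ}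
    (A : Matrix (Fin m) (Fin n) R) : Prop :=
  ∃ (M : GL (Fin m) R) (N : GL (Fin n) R) (D : Matrix (Fin m) (Fin n) R),
    (M : Matrix (Fin m) (Fin m) R) * A * (N : Matrix (Fin n) (Fin n) R) = D ∧
    (∀ (i : Fin m) (j : Fin n), (i : ℕ) ≠ (j : ℕ) → D i j = 0) ∧
    ∀ (i : ℕ) (hm : i + 1 < m) (hn : i + 1 < n),
      D ⟨i, Nat.lt_of_succ_lt hm⟩ ⟨i, Nat.lt_of_succ_lt hn⟩ ∣ D ⟨i + 1, hm⟩ ⟨i + 1, hn⟩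

/-- Elementary divisor ring (EDR). -/
def IsEDR (R : Type u) [CommRing R] : Prop :=
  ∀ m n : ℕ, 0 < m → 0 < n → ∀ A : Matrix (Fin m) (Fin n) R, AdmitsDiagonalReduction A

/-- `(WSU)ₙ` ring: each unimodular `n × n` matrix becomes symmetric after right multiplication by
some invertible matrix. -/
def IsWSU (n : ℕ) (R : Type u) [CommRing R] : Prop :=
  ∀ A : Matrix (Fin n) (Fin n) R, IsUnimodular A →
    ∃ N : GL (Fin n) R, (A * (N : Matrix (Fin n) (Fin n) R)).IsSymm

/-- The reduction homomorphism `U(R/Rac) → U(R/Rc)`. -/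
def unitsReduction {R : Type u} [CommRing R] (a c : R) :
    (R ⧸ Ideal.span {a * c})ˣ →* (R ⧸ Ideal.span {c})ˣ :=
  Units.map (Ideal.Quotient.factor
    (Ideal.span_singleton_le_span_singleton.mpr (dvd_mul_left c a))).toMonoidHom

/-- The product homomorphism `υ_{a,b,c} : U(R/Rac) × U(R/Rbc) → U(R/Rc)`. -/
def upsilon {R : Type u} [CommRing R] (a b c : R) :
    (R ⧸ Ideal.span {a * c})ˣ × (R ⧸ Ideal.span {b * c})ˣ →* (R ⧸ Ideal.span {c})ˣ :=
  (unitsReduction a c).coprod (unitsReduction b c)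

/-- The group `Coker(υ_{a,b,c})`. -/
abbrev CokerUpsilon {R : Type u} [CommRing R] (a b c : R) : Type u :=
  (R ⧸ Ideal.span {c})ˣ ⧸ (upsilon a b c).range

/-- A Boolean group: every element has square equal to the identity. -/
def IsBooleanGroup (G : Type u) [Group G] : Prop :=
  ∀ x : G, x ^ 2 = 1

/-- `P` is a projective `S`-module of (constant) rank `1` generated by `2` elements. -/
structure IsProjectiveRankOneTwoGenerated (S : Type u) [CommRing S]
    (P : Type u) [AddCommGroup P] [Module S P] : Prop where
  projective : Module.Projective S P
  rank_eq_one : ∀ p : PrimeSpectrum S, Module.rankAtStalk P p = 1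
  generated : ∃ x y : P, Submodule.span S {x, y} = ⊤

/-- `P` is self-dual: it is isomorphic to `Hom_S(P, S)`. -/
def IsSelfDual (S : Type u) [CommRing S] (P : Type u) [AddCommGroup P] [Module S P] : Prop :=
  Nonempty (P ≃ₗ[S] Module.Dual S P)

/-- Every self-dual projective `S`-module of rank `1` generated by `2` elements is free.
Modules in the universe of `S` suffice, since each finitely generated module has a copy there. -/
def SelfDualRankOneTwoGeneratedFree (S : Type u) [CommRing S] : Prop :=
  ∀ (P : Type u) [AddCommGroup P] [Module S P],
    IsProjectiveRankOneTwoGenerated S P → IsSelfDual S P → Module.Free S P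

end HermiteRings

namespace HermiteRings

universe u

/-! Over a Hermite ring, being an EDR reduces to `UnimodularMatricesRepresentOne`: a form value
dividing all entries can be split off as a pivot (`IsHermite.isEDR`). By
`IsHermite.exists_value_eq_one`, it suffices that `A` maps some vector to one unimodular modulo `d =
det A`.

Symmetric matrices are handled by the hypothesis on modules. Modulo `d`, the columns of a unimodular
symmetric matrix span a module `P` with `P ⊗ P ≅ S`; it is self-dual, hence free, and its generator
is a unimodular image vector (`SelfDualRankOneTwoGeneratedFree.exists_isCoprime`). The `(WSU)₂`
condition makes `A` symmetric. For a triangular `A` with diagonal `ca`, `cb` and corner `β`, a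
factorization of `β²` modulo `c` yields an auxiliary symmetric matrix modulo `d` that kills every
vector killed by `A` at each maximal ideal containing `d`
(`exists_unimodular_image_of_factorization`). Only the square of `β` enters, so a Boolean cokernel
suffices.

Conversely, diagonalizing a matrix that interpolates between two rank one projections factors every
unit modulo `c` (`IsEDR.exists_factorization`). -/

/-! ### Self-dual modules spanned by the columns of a symmetric matrix -/

open TensorProduct in
/-- A module is invertible if it carries a bilinear form that takes the value `1` on some tensor and
whose arguments may be exchanged with an external factor. -/
theorem nonempty_tensor_self_equiv {S M : Type*} [CommRing S] [AddCommGroup M] [Module S M]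
    (φ : M →ₗ[S] M →ₗ[S] S) (hl : ∀ u v w, φ v w • u = φ u w • v)
    (hr : ∀ u v w, φ u v • w = φ u w • v) (τ : M ⊗[S] M) (hτ : TensorProduct.lift φ τ = 1) :
    Nonempty (M ⊗[S] M ≃ₗ[S] S) := by
  -- For `σ = τ` the right-hand factor is `1`, so `s ↦ s • τ` inverts `lift φ`.
  have key : ∀ v w : M, ∀ σ : M ⊗[S] M,
      φ v w • σ = TensorProduct.lift φ σ • (v ⊗ₜ[S] w) := by
    intro v w σ
    induction σ with
    | zero => simp
    | add x y hx hy => rw [smul_add, hx, hy, map_add, add_smul]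
    | tmul a b =>
      rw [TensorProduct.lift.tmul, TensorProduct.smul_tmul', hl, TensorProduct.smul_tmul, hr a w b,
        TensorProduct.tmul_smul]
  refine ⟨LinearEquiv.ofLinearMap (TensorProduct.lift φ) (LinearMap.toSpanSingleton S _ τ) ?_ ?_⟩
  · ext; simp [hτ]
  · ext v w
    simp [key v w τ, hτ]

theorem rankAtStalk_eq_one_of_invertible {S M : Type*} [CommRing S] [AddCommGroup M] [Module S M]
    [Module.Invertible S M] (p : PrimeSpectrum S) : Module.rankAtStalk M p = 1 := by
  have : Module.Free (Localization.AtPrime p.asIdeal)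
      (LocalizedModule p.asIdeal.primeCompl M) := Module.free_of_flat_of_isLocalRing
  exact Module.Invertible.finrank_eq_one _ _

/-- The bilinear form `(v, w) ↦ α v₁ w₁ + β v₁ w₂ + γ v₂ w₂` on a submodule of `S²`. -/
def triangularForm {S : Type*} [CommRing S] (α β γ : S) (P : Submodule S (S × S)) :
    P →ₗ[S] P →ₗ[S] S :=
  LinearMap.mk₂ S (fun v w => α * v.1.1 * w.1.1 + β * v.1.1 * w.1.2 + γ * v.1.2 * w.1.2)
    (by intros; simp; ring) (by intros; simp; ring) (by intros; simp; ring)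
    (by intros; simp; ring)

theorem triangularForm_apply {S : Type*} [CommRing S] (α β γ : S) (P : Submodule S (S × S))
    (v w : P) : triangularForm α β γ P v w =
      α * v.1.1 * w.1.1 + β * v.1.1 * w.1.2 + γ * v.1.2 * w.1.2 := rfl

/-- If self-dual projective `S`-modules of rank one generated by two elements are free, then each
unimodular symmetric `2 × 2` matrix of determinant `0` maps some vector to a unimodular one. -/
theorem SelfDualRankOneTwoGeneratedFree.exists_isCoprime {S : Type u} [CommRing S]
    (h : SelfDualRankOneTwoGeneratedFree S) {p q r α β γ : S} (hdet : p * r = q * q)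
    (huni : α * p + β * q + γ * r = 1) :
    ∃ y₁ y₂ : S, IsCoprime (p * y₁ + q * y₂) (q * y₁ + r * y₂) := by
  let P : Submodule S (S × S) := Submodule.span S {(p, q), (q, r)}
  have hk₁ : (p, q) ∈ P := Submodule.subset_span (by simp)
  have hk₂ : (q, r) ∈ P := Submodule.subset_span (by simp)
  let k₁ : P := ⟨_, hk₁⟩
  let k₂ : P := ⟨_, hk₂⟩
  have hP : ∀ v : P, ∃ a b : S, v = a • k₁ + b • k₂ := by
    intro v
    obtain ⟨a, b, hab⟩ := Submodule.mem_span_pair.mp v.2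
    exact ⟨a, b, Subtype.ext hab.symm⟩
  have hdep : ∀ v w : P, v.1.1 * w.1.2 = v.1.2 * w.1.1 := by
    intro v w
    obtain ⟨a, b, rfl⟩ := hP v
    obtain ⟨c, d, rfl⟩ := hP w
    simp [k₁, k₂]
    linear_combination (a * d - b * c) * hdet
  -- Vectors of `P` are proportional by `hdep`, which gives the exchange identities. The form takes
  -- the values `p`, `q`, `r` on `(k₁, k₁)`, `(k₁, k₂)`, `(k₂, k₂)`, so `τ` has value `α * p + β * q
  -- + γ * r = 1`.
  let φ := triangularForm α β γ P
  let τ : TensorProduct S P P := α • TensorProduct.tmul S k₁ k₁ +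
    β • TensorProduct.tmul S k₁ k₂ + γ • TensorProduct.tmul S k₂ k₂
  obtain ⟨e⟩ : Nonempty (TensorProduct S P P ≃ₗ[S] S) := by
    refine nonempty_tensor_self_equiv φ ?_ ?_ τ ?_
    · intro u v w
      have := hdep u v
      ext
      · simp [φ, triangularForm_apply]
        linear_combination (γ * w.1.2) * this
      · simp [φ, triangularForm_apply]
        linear_combination (-α * w.1.1 - β * w.1.2) * this
    · intro u v w
      have := hdep v w
      ext
      · simp [φ, triangularForm_apply]
        linear_combination (-β * u.1.1 - γ * u.1.2) * this
      · simp [φ, triangularForm_apply]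
        linear_combination (α * u.1.1) * this
    · simp [τ, φ, triangularForm_apply, k₁, k₂]
      have e₁ : α * p * p + β * p * q + γ * q * q = p := by
        linear_combination p * huni - γ * hdet
      have e₂ : α * p * q + β * p * r + γ * q * r = q := by
        linear_combination q * huni + β * hdet
      have e₃ : α * q * q + β * q * r + γ * r * r = r := by
        linear_combination r * huni - α * hdet
      rw [e₁, e₂, e₃, huni]
  have : Module.Invertible S P := Module.Invertible.left e
  have hfree : Module.Free S P := by
    refine h P ⟨inferInstance, rankAtStalk_eq_one_of_invertible, k₁, k₂, ?_⟩
      ⟨Module.Invertible.linearEquivDual e⟩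
    refine eq_top_iff.mpr fun v _ => ?_
    obtain ⟨a, b, hab⟩ := hP v
    exact Submodule.mem_span_pair.mpr ⟨a, b, hab.symm⟩
  obtain ⟨ε⟩ := Module.Invertible.free_iff_linearEquiv.mp hfree
  have hgen : ∀ v : P, ε v • ε.symm 1 = v := by
    intro v
    rw [← map_smul, smul_eq_mul, mul_one, ε.symm_apply_apply]
  obtain ⟨y₁, y₂, hy⟩ := hP (ε.symm 1)
  have h₁ := hgen k₁
  have h₂ := hgen k₂
  rw [hy] at h₁ h₂
  simp only [Subtype.ext_iff, Prod.ext_iff, k₁, k₂] at h₁ h₂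
  simp at h₁ h₂
  -- Each `kᵢ` is `ε kᵢ` times the generator; `huni` is rewritten with `p`, `q` as multiples of its
  -- first coordinate and `r` of its second.
  refine ⟨y₁, y₂, α * ε k₁ + β * ε k₂, γ * ε k₂, ?_⟩
  simp only [k₁, k₂]
  linear_combination α * h₁.1 + β * h₂.1 + γ * h₂.2 + huni

/-- The preceding statement for `R / Rd`, in terms of elements of `R`. -/
theorem exists_unimodular_image_of_symmetric {R : Type u} [CommRing R] {d : R}
    (h : SelfDualRankOneTwoGeneratedFree (R ⧸ Ideal.span {d})) {p q r α β γ δ : R}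
    (hdet : d ∣ p * r - q * q) (huni : α * p + β * q + γ * r + δ * d = 1) :
    ∃ y₁ y₂ s t w : R, s * (p * y₁ + q * y₂) + t * (q * y₁ + r * y₂) + w * d = 1 := by
  let π := Ideal.Quotient.mk (Ideal.span {d})
  have hd : π d = 0 := Ideal.Quotient.eq_zero_iff_mem.mpr (Ideal.mem_span_singleton_self d)
  have hdet' : π p * π r = π q * π q := by
    rw [← map_mul, ← map_mul]
    exact Ideal.Quotient.eq.mpr (Ideal.mem_span_singleton.mpr hdet)
  have huni' : π α * π p + π β * π q + π γ * π r = 1 := by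
    simpa [hd] using congrArg π huni
  obtain ⟨y₁, y₂, s, t, hst⟩ := h.exists_isCoprime hdet' huni'
  obtain ⟨y₁, rfl⟩ := Ideal.Quotient.mk_surjective y₁
  obtain ⟨y₂, rfl⟩ := Ideal.Quotient.mk_surjective y₂
  obtain ⟨s, rfl⟩ := Ideal.Quotient.mk_surjective s
  obtain ⟨t, rfl⟩ := Ideal.Quotient.mk_surjective t
  have : d ∣ 1 - (s * (p * y₁ + q * y₂) + t * (q * y₁ + r * y₂)) := by
    refine Ideal.mem_span_singleton.mp (Ideal.Quotient.eq.mp ?_)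
    simpa [π] using hst.symm
  obtain ⟨w, hw⟩ := this
  exact ⟨y₁, y₂, s, t, w, by linear_combination -hw⟩

/-! ### Values of bilinear forms over Hermite rings -/

open Matrix

section

variable {R : Type*} [CommRing R]

/-- Over a Hermite ring, a `2 × 2` matrix which maps some vector to a vector that is unimodular
modulo the determinant represents `1` as a bilinear form. -/
theorem IsHermite.exists_value_eq_one (hR : IsHermite R) {a b c e y₁ y₂ s t w : R}
    (h : s * (a * y₁ + b * y₂) + t * (c * y₁ + e * y₂) + w * (a * e - b * c) = 1) :
    ∃ x₁ x₂ z₁ z₂ : R, x₁ * (a * z₁ + b * z₂) + x₂ * (c * z₁ + e * z₂) = 1 := by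
  obtain ⟨k, k₁, k₂, ⟨m₁, m₂, hm⟩, rfl, rfl⟩ := hR y₁ y₂
  set d := a * e - b * c with hd
  set f := s * (a * k₁ + b * k₂) + t * (c * k₁ + e * k₂) with hf
  have hfk : f * k + w * d = 1 := by linear_combination h
  -- Adding `d • (-m₂, m₁)` to `y = k • (k₁, k₂)` leaves `y` unchanged modulo `d` and makes it
  -- unimodular, since `k` and `d` are coprime.
  let z₁ := k * k₁ - d * m₂
  let z₂ := k * k₂ + d * m₁
  let μ₁ := f * m₁ - w * k₂
  let μ₂ := f * m₂ + w * k₁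
  have hμ : μ₁ * z₁ + μ₂ * z₂ = 1 := by
    simp only [μ₁, μ₂, z₁, z₂]
    linear_combination (f * k + w * d) * hm + hfk
  -- The vectors `z` and `(-μ₂, μ₁)` have determinant `1`, so their images have determinant `d`.
  -- Thus `d` lies in the ideal of the entries of the image of `z`, which is therefore unimodular,
  -- not only modulo `d`.
  have hdet : (a * z₁ + b * z₂) * (-c * μ₂ + e * μ₁) - (c * z₁ + e * z₂) * (-a * μ₂ + b * μ₁) = d := by
    linear_combination d * hμ
  let K := w - s * (-a * m₂ + b * m₁) - t * (-c * m₂ + e * m₁)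
  refine ⟨s + K * (-c * μ₂ + e * μ₁), t - K * (-a * μ₂ + b * μ₁), z₁, z₂, ?_⟩
  linear_combination K * hdet + h

/-- Every unimodular `2 × 2` matrix represents `1` as a bilinear form. -/
def UnimodularMatricesRepresentOne (R : Type*) [CommRing R] : Prop :=
  ∀ a b c e α β γ δ : R, α * a + β * b + γ * c + δ * e = 1 →
    ∃ x₁ x₂ y₁ y₂ : R, x₁ * (a * y₁ + b * y₂) + x₂ * (c * y₁ + e * y₂) = 1

theorem IsHermite.exists_value_dvd_of_two (hR : IsHermite R) (h : UnimodularMatricesRepresentOne R)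
    (a b c e : R) : ∃ x₁ x₂ y₁ y₂ g : R, g = x₁ * (a * y₁ + b * y₂) + x₂ * (c * y₁ + e * y₂) ∧
      g ∣ a ∧ g ∣ b ∧ g ∣ c ∧ g ∣ e := by
  obtain ⟨d, a, b, ⟨α, β, hab⟩, rfl, rfl⟩ := hR a b
  obtain ⟨d', c, e, ⟨γ, δ, hce⟩, rfl, rfl⟩ := hR c e
  obtain ⟨g, k, l, ⟨m, n, hkl⟩, rfl, rfl⟩ := hR d d'
  obtain ⟨x₁, x₂, y₁, y₂, hxy⟩ := h (k * a) (k * b) (l * c) (l * e) (m * α) (m * β) (n * γ) (n * δ)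
    (by linear_combination m * k * hab + n * l * hce + hkl)
  exact ⟨x₁, x₂, y₁, y₂, g, by linear_combination -g * hxy, by simp [mul_assoc],
    by simp [mul_assoc], by simp [mul_assoc], by simp [mul_assoc]⟩

/-- Induction on the columns: the tail is replaced by the single column obtained from `y'`. A common
divisor of that column divides the tail's value, hence all tail entries. -/
theorem IsHermite.exists_value_dvd_of_two_rows (hR : IsHermite R)
    (h : UnimodularMatricesRepresentOne R) :
    ∀ {n : ℕ} (u v : Fin n → R), ∃ (s t : R) (y : Fin n → R),
      ∀ j, s * (u ⬝ᵥ y) + t * (v ⬝ᵥ y) ∣ u j ∧ s * (u ⬝ᵥ y) + t * (v ⬝ᵥ y) ∣ v j := by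
  intro n
  induction n with
  | zero => exact fun u v => ⟨0, 0, 0, fun j => j.elim0⟩
  | succ n ih =>
    intro u v
    obtain ⟨s', t', y', hy'⟩ := ih (Fin.tail u) (Fin.tail v)
    obtain ⟨s, t, z₁, z₂, g, hg, h₁, h₂, h₃, h₄⟩ :=
      hR.exists_value_dvd_of_two h (u 0) (Fin.tail u ⬝ᵥ y') (v 0) (Fin.tail v ⬝ᵥ y')
    have hdot : ∀ w : Fin (n + 1) → R, w ⬝ᵥ (Fin.cons z₁ (z₂ • y') : Fin (n + 1) → R) =
        w 0 * z₁ + (Fin.tail w ⬝ᵥ y') * z₂ := by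
      intro w
      rw [dotProduct, Fin.sum_univ_succ]
      simp only [Fin.cons_zero, Fin.cons_succ]
      congr 1
      change Fin.tail w ⬝ᵥ (z₂ • y') = _
      rw [dotProduct_smul, smul_eq_mul, mul_comm]
    refine ⟨s, t, Fin.cons z₁ (z₂ • y'), ?_⟩
    rw [hdot, hdot, ← hg]
    have hdvd : g ∣ s' * (Fin.tail u ⬝ᵥ y') + t' * (Fin.tail v ⬝ᵥ y') :=
      dvd_add (h₂.mul_left _) (h₄.mul_left _)
    intro j
    refine Fin.cases ⟨h₁, h₃⟩ (fun j => ?_) j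
    exact ⟨hdvd.trans (hy' j).1, hdvd.trans (hy' j).2⟩

/-- If unimodular `2 × 2` matrices over a Hermite ring represent `1`, then each matrix represents a
common divisor of its entries. -/
theorem IsHermite.exists_value_dvd (hR : IsHermite R) (h : UnimodularMatricesRepresentOne R)
    {m n : ℕ} (A : Matrix (Fin m) (Fin n) R) :
    ∃ (x : Fin m → R) (y : Fin n → R), ∀ i j, x ⬝ᵥ (A *ᵥ y) ∣ A i j := by
  induction m with
  | zero => exact ⟨0, 0, fun i => i.elim0⟩
  | succ m ih =>
    obtain ⟨x', y', hxy⟩ := ih (A.submatrix Fin.succ id)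
    obtain ⟨s, t, y, hy⟩ :=
      hR.exists_value_dvd_of_two_rows h (A 0) (x' ᵥ* A.submatrix Fin.succ id)
    have hval : (Fin.cons s (t • x') : Fin (m + 1) → R) ⬝ᵥ (A *ᵥ y) =
        s * (A 0 ⬝ᵥ y) + t * ((x' ᵥ* A.submatrix Fin.succ id) ⬝ᵥ y) := by
      rw [dotProduct, Fin.sum_univ_succ, ← dotProduct_mulVec]
      simp only [Fin.cons_zero, Fin.cons_succ]
      congr 1
      change (t • x') ⬝ᵥ (A.submatrix Fin.succ id *ᵥ y) = _
      rw [smul_dotProduct, smul_eq_mul]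
    refine ⟨Fin.cons s (t • x'), y, ?_⟩
    rw [hval]
    set g := s * (A 0 ⬝ᵥ y) + t * ((x' ᵥ* A.submatrix Fin.succ id) ⬝ᵥ y)
    intro i j
    refine Fin.cases (hy j).1 (fun i => ?_) i
    refine dvd_trans ?_ (hxy i j)
    rw [dotProduct_mulVec]
    exact Finset.dvd_sum fun k _ => (hy k).2.mul_right _

/-! ### Changes of coordinates over Hermite rings -/

/-- Over a Hermite ring, each finite nonempty family is a multiple of a unimodular family. -/
theorem IsHermite.exists_eq_mul_unimodular (hR : IsHermite R) {ι : Type*} (v : ι → R)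
    {s : Finset ι} (hs : s.Nonempty) :
    ∃ (g : R) (v' c : ι → R), (∀ i ∈ s, v i = g * v' i) ∧ ∑ i ∈ s, c i * v' i = 1 := by
  classical
  induction hs using Finset.Nonempty.cons_induction with
  | singleton a => exact ⟨v a, 1, 1, by simp⟩
  | cons a s ha hs ih =>
    obtain ⟨g, v', c, hv, hc⟩ := ih
    obtain ⟨d, p, q, ⟨m, n, hmn⟩, hp, rfl⟩ := hR (v a) g
    have hne : ∀ i ∈ s, i ≠ a := fun i hi h => ha (h ▸ hi)
    refine ⟨d, Function.update (q • v') a p, Function.update (n • c) a m, ?_, ?_⟩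
    · intro i hi
      rcases Finset.mem_cons.mp hi with rfl | hi
      · simpa using hp
      · rw [Function.update_of_ne (hne i hi), hv i hi, Pi.smul_apply, smul_eq_mul, mul_assoc]
    · rw [Finset.sum_cons, Finset.sum_congr rfl fun i hi => by
        rw [Function.update_of_ne (hne i hi), Function.update_of_ne (hne i hi)]]
      have : ∑ i ∈ s, (n • c) i * (q • v') i = n * q := by
        rw [← mul_one (n * q), ← hc, Finset.mul_sum]
        exact Finset.sum_congr rfl fun i _ => by simp; ring
      rw [this]
      simpa using hmn

/-- Over a Hermite ring, a linear form in `n + 1` variables is a multiple of the first coordinate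
after a change of coordinates. -/
theorem IsHermite.exists_linearEquiv_eq_mul (hR : IsHermite R) : ∀ {n : ℕ} (x : Fin (n + 1) → R),
    ∃ (g : R) (e : (Fin (n + 1) → R) ≃ₗ[R] (Fin (n + 1) → R)), ∀ w, x ⬝ᵥ w = g * e w 0 := by
  intro n
  induction n with
  | zero => exact fun x => ⟨x 0, .refl _ _, fun w => by simp [dotProduct]⟩
  | succ n ih =>
    intro x
    obtain ⟨g', e', he'⟩ := ih (Fin.tail x)
    obtain ⟨g, a, b, ⟨s, t, hst⟩, hx, rfl⟩ := hR (x 0) g'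
    -- The matrix with rows `(a, b)` and `(-t, s)`, of determinant `1`, acts on the first coordinate
    -- of `w` and that of `e' (Fin.tail w)`.
    let f : (Fin (n + 2) → R) → Fin (n + 2) → R := fun w =>
      Fin.cons (a * w 0 + b * e' (Fin.tail w) 0)
        (Fin.cons (-t * w 0 + s * e' (Fin.tail w) 0) (Fin.tail (e' (Fin.tail w))))
    let f' : (Fin (n + 2) → R) → Fin (n + 2) → R := fun u =>
      Fin.cons (s * u 0 - b * u 1)
        (e'.symm (Fin.cons (t * u 0 + a * u 1) (Fin.tail (Fin.tail u))))
    refine ⟨g, LinearEquiv.mk ⟨⟨f, ?_⟩, ?_⟩ f' ?_ ?_, ?_⟩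
    · intro u v
      have : Fin.tail (u + v) = Fin.tail u + Fin.tail v := rfl
      ext i
      refine Fin.cases ?_ (fun i => Fin.cases ?_ (fun i => ?_) i) i <;> simp [f, this, Fin.tail]
        <;> ring
    · intro c v
      have : Fin.tail (c • v) = c • Fin.tail v := rfl
      ext i
      refine Fin.cases ?_ (fun i => Fin.cases ?_ (fun i => ?_) i) i <;> simp [f, this, Fin.tail]
        <;> ring
    · intro w
      have h₀ : s * f w 0 - b * f w 1 = w 0 := by
        simp [f]; linear_combination w 0 * hst
      have h₁ : t * f w 0 + a * f w 1 = e' (Fin.tail w) 0 := by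
        simp [f]; linear_combination e' (Fin.tail w) 0 * hst
      have h₂ : Fin.tail (Fin.tail (f w)) = Fin.tail (e' (Fin.tail w)) := by simp [f]
      change f' (f w) = w
      simp only [f', h₀, h₁, h₂]
      rw [Fin.cons_self_tail, e'.symm_apply_apply, Fin.cons_self_tail]
    · intro u
      change f (f' u) = u
      ext i
      refine Fin.cases ?_ (fun i => Fin.cases ?_ (fun i => ?_) i) i
      · simp [f, f']; linear_combination u 0 * hst
      · simp [f, f']; linear_combination u 1 * hst
      · simp [f, f', Fin.tail]
    · intro w
      change _ = g * (a * w 0 + b * e' (Fin.tail w) 0)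
      have := he' (Fin.tail w)
      rw [dotProduct, Fin.sum_univ_succ, hx]
      change g * a * w 0 + Fin.tail x ⬝ᵥ Fin.tail w = _
      rw [this]
      ring

/-- Over a Hermite ring, a pair of a linear form and a vector on which it takes the value `1`
becomes the standard one after a change of coordinates. -/
theorem IsHermite.exists_GL_of_dotProduct_eq_one (hR : IsHermite R) {n : ℕ} {x z : Fin (n + 1) → R}
    (h : x ⬝ᵥ z = 1) :
    ∃ M : GL (Fin (n + 1)) R, (∀ w, (M.val *ᵥ w) 0 = x ⬝ᵥ w) ∧
      M.val *ᵥ z = Pi.single 0 1 := by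
  obtain ⟨g, e, he⟩ := hR.exists_linearEquiv_eq_mul x
  have hg : g * e z 0 = 1 := by rw [← he, h]
  -- By `hg`, `g` is a unit, so `x ⬝ᵥ w` can serve as first coordinate; the subtraction clears the
  -- other coordinates of `z`.
  let f : (Fin (n + 1) → R) → Fin (n + 1) → R := fun w =>
    Fin.cons (x ⬝ᵥ w) (Fin.tail (e w) - (x ⬝ᵥ w) • Fin.tail (e z))
  let f' : (Fin (n + 1) → R) → Fin (n + 1) → R := fun u =>
    e.symm (Fin.cons (e z 0 * u 0) (Fin.tail u + u 0 • Fin.tail (e z)))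
  obtain ⟨ε, hε⟩ : ∃ ε : (Fin (n + 1) → R) ≃ₗ[R] (Fin (n + 1) → R), ∀ w, ε w = f w := by
    refine ⟨LinearEquiv.mk ⟨⟨f, ?_⟩, ?_⟩ f' ?_ ?_, fun _ => rfl⟩
    · intro u v
      ext i
      refine Fin.cases ?_ (fun i => ?_) i <;> simp [f, Fin.tail, dotProduct_add]
      ring
    · intro c v
      ext i
      refine Fin.cases ?_ (fun i => ?_) i <;> simp [f, Fin.tail]
      ring
    · intro w
      change e.symm _ = w
      rw [LinearEquiv.symm_apply_eq]
      ext i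
      refine Fin.cases ?_ (fun i => ?_) i <;> simp [f, Fin.tail]
      rw [he]; linear_combination e w 0 * hg
    · intro u
      have hx : x ⬝ᵥ f' u = u 0 := by
        rw [he]; simp [f']; linear_combination u 0 * hg
      change f (f' u) = u
      simp only [f, hx]
      ext i
      refine Fin.cases ?_ (fun i => ?_) i <;> simp [f', Fin.tail]
  refine ⟨⟨LinearMap.toMatrix' ε.toLinearMap, LinearMap.toMatrix' ε.symm.toLinearMap, ?_, ?_⟩,
    ?_, ?_⟩
  · rw [← LinearMap.toMatrix'_comp]; simp
  · rw [← LinearMap.toMatrix'_comp]; simp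
  · intro w
    change (LinearMap.toMatrix' ε.toLinearMap *ᵥ w) 0 = _
    rw [LinearMap.toMatrix'_mulVec]
    simp [hε, f]
  · change LinearMap.toMatrix' ε.toLinearMap *ᵥ z = _
    rw [LinearMap.toMatrix'_mulVec]
    ext i
    refine Fin.cases ?_ (fun i => ?_) i <;> simp [hε, f, h, Fin.tail]

/-! ### Splitting off a pivot and diagonal reduction -/

/-- The block diagonal matrix with blocks `1` and `A`. -/
def oneBlock {m n : ℕ} (A : Matrix (Fin m) (Fin n) R) : Matrix (Fin (m + 1)) (Fin (n + 1)) R :=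
  Matrix.of (Fin.cons (Fin.cons 1 0) fun i => Fin.cons 0 (A i))

section oneBlock

variable {l m n : ℕ} (A : Matrix (Fin m) (Fin n) R)

@[simp] theorem oneBlock_zero_zero : oneBlock A 0 0 = 1 := rfl

@[simp] theorem oneBlock_zero_succ (j : Fin n) : oneBlock A 0 j.succ = 0 := rfl

@[simp] theorem oneBlock_succ_zero (i : Fin m) : oneBlock A i.succ 0 = 0 := rfl

@[simp] theorem oneBlock_succ_succ (i : Fin m) (j : Fin n) :
    oneBlock A i.succ j.succ = A i j := rfl

theorem oneBlock_mul (B : Matrix (Fin l) (Fin m) R) :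
    oneBlock B * oneBlock A = oneBlock (B * A) := by
  ext i j
  refine Fin.cases ?_ (fun i => ?_) i <;> refine Fin.cases ?_ (fun j => ?_) j <;>
    simp [Matrix.mul_apply, Fin.sum_univ_succ]

theorem oneBlock_one : oneBlock (1 : Matrix (Fin n) (Fin n) R) = 1 := by
  ext i j
  refine Fin.cases ?_ (fun i => ?_) i <;> refine Fin.cases ?_ (fun j => ?_) j <;>
    simp [Matrix.one_apply, Fin.succ_ne_zero, (Fin.succ_ne_zero _).symm]

end oneBlock

/-- The block diagonal invertible matrix with blocks `1` and `M`. -/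
def oneBlockGL {n : ℕ} (M : GL (Fin n) R) : GL (Fin (n + 1)) R :=
  ⟨oneBlock M.val, oneBlock M⁻¹.val, by
    rw [oneBlock_mul, ← Units.val_mul]; simp [oneBlock_one],
    by rw [oneBlock_mul, ← Units.val_mul]; simp [oneBlock_one]⟩

theorem AdmitsDiagonalReduction.smul_oneBlock {m n : ℕ} {A : Matrix (Fin m) (Fin n) R} (g : R)
    (h : AdmitsDiagonalReduction A) : AdmitsDiagonalReduction (g • oneBlock A) := by
  obtain ⟨M, N, D, hD, hoff, hdvd⟩ := h
  refine ⟨oneBlockGL M, oneBlockGL N, g • oneBlock D, ?_, ?_, ?_⟩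
  · change oneBlock _ * (g • oneBlock A) * oneBlock _ = _
    rw [Matrix.mul_smul, Matrix.smul_mul, oneBlock_mul, oneBlock_mul, hD]
  · intro i j
    refine Fin.cases ?_ (fun i => ?_) i <;> refine Fin.cases ?_ (fun j => ?_) j
    · simp
    · simp
    · simp
    · intro hij
      simp [hoff i j (by simpa using hij)]
  · intro i hm hn
    cases i with
    | zero =>
      change g * 1 ∣ g * oneBlock D (Fin.succ ⟨0, by omega⟩) (Fin.succ ⟨0, by omega⟩)
      rw [mul_one]
      exact dvd_mul_right _ _
    | succ i => exact mul_dvd_mul_left g (hdvd i (by omega) (by omega))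

theorem AdmitsDiagonalReduction.of_mul {m n : ℕ} {A : Matrix (Fin m) (Fin n) R} (M : GL (Fin m) R)
    (N : GL (Fin n) R)
    (h : AdmitsDiagonalReduction (M.val * A * N.val)) :
    AdmitsDiagonalReduction A := by
  obtain ⟨M', N', D, hD, h⟩ := h
  refine ⟨M' * M, N * N', D, ?_, h⟩
  rw [← hD]
  simp only [Units.val_mul, Matrix.mul_assoc]

/-- Coordinates adapted to the pairs `(x, A *ᵥ y)` and `(x ᵥ* A, y)` make both the first row and the
first column standard. -/
theorem IsHermite.exists_mul_mul_eq_oneBlock (hR : IsHermite R) {m n : ℕ}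
    {A : Matrix (Fin (m + 1)) (Fin (n + 1)) R} {x : Fin (m + 1) → R} {y : Fin (n + 1) → R}
    (h : x ⬝ᵥ (A *ᵥ y) = 1) :
    ∃ (M : GL (Fin (m + 1)) R) (N : GL (Fin (n + 1)) R) (B : Matrix (Fin m) (Fin n) R),
      M.val * A * N.val = oneBlock B := by
  obtain ⟨M, hM, hMy⟩ := hR.exists_GL_of_dotProduct_eq_one h
  obtain ⟨K, hK, hKy⟩ := hR.exists_GL_of_dotProduct_eq_one (x := x ᵥ* A) (z := y)
    (by rw [← dotProduct_mulVec, h])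
  have hKK : K.val * K⁻¹.val = 1 := by
    rw [← Units.val_mul]; simp
  have hKK' : K⁻¹.val * K.val = 1 := by
    rw [← Units.val_mul]; simp
  set C := M.val * A * K⁻¹.val with hC
  have hrow : ∀ w, (C *ᵥ w) 0 = w 0 := by
    intro w
    rw [hC, ← mulVec_mulVec, ← mulVec_mulVec, hM, dotProduct_mulVec, ← hK, mulVec_mulVec, hKK,
      one_mulVec]
  have hcol : C *ᵥ Pi.single 0 1 = Pi.single 0 1 := by
    rw [← hKy, hC, mulVec_mulVec, Matrix.mul_assoc, Matrix.mul_assoc, hKK', Matrix.mul_one,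
      ← mulVec_mulVec, hMy]
  refine ⟨M, K⁻¹, C.submatrix Fin.succ Fin.succ, ?_⟩
  change C = _
  ext i j
  have hr := hrow (Pi.single j 1)
  have hc := congrFun hcol i
  rw [mulVec_single_one, col_apply] at hr hc
  revert hr hc
  refine Fin.cases ?_ (fun i => ?_) i <;> refine Fin.cases ?_ (fun j => ?_) j <;>
    intro hr hc <;> simp_all

/-- Kaplansky: a Hermite ring is an elementary divisor ring if unimodular `2 × 2` matrices
represent `1`. -/
theorem IsHermite.isEDR (hR : IsHermite R) (h : UnimodularMatricesRepresentOne R) : IsEDR R := by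
  suffices H : ∀ (m n : ℕ) (A : Matrix (Fin m) (Fin n) R), AdmitsDiagonalReduction A from
    fun m n _ _ A => H m n A
  intro m
  induction m with
  | zero => exact fun n A => ⟨1, 1, A, by simp, fun i => i.elim0, fun i hi => by omega⟩
  | succ m ih =>
    intro n A
    cases n with
    | zero => exact ⟨1, 1, A, by simp, fun i j => j.elim0, fun i _ hi => by omega⟩
    | succ n =>
      obtain ⟨g, A', c, hA, hc⟩ := hR.exists_eq_mul_unimodular
        (fun p : Fin (m + 1) × Fin (n + 1) => A p.1 p.2) Finset.univ_nonempty
      let A₀ : Matrix (Fin (m + 1)) (Fin (n + 1)) R := Matrix.of fun i j => A' (i, j)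
      have hA₀ : A = g • A₀ := by
        ext i j
        exact hA (i, j) (Finset.mem_univ _)
      obtain ⟨x, y, hxy⟩ := hR.exists_value_dvd h A₀
      have hunit : IsUnit (x ⬝ᵥ (A₀ *ᵥ y)) := by
        refine isUnit_of_dvd_one ?_
        rw [← hc]
        exact Finset.dvd_sum fun p _ => (hxy p.1 p.2).mul_left _
      obtain ⟨u, hu⟩ := hunit.exists_left_inv
      obtain ⟨M, N, B, hB⟩ := hR.exists_mul_mul_eq_oneBlock (A := A₀) (x := u • x) (y := y)
        (by rw [smul_dotProduct, smul_eq_mul, hu])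
      refine .of_mul M N ?_
      rw [hA₀, Matrix.mul_smul, Matrix.smul_mul, hB]
      exact (ih n B).smul_oneBlock g

end

/-! ### Units modulo `c` and the cokernel of `υ` -/

section

variable {R : Type u} [CommRing R]

/-- Four elements without a common zero in a field generate the unit ideal. -/
theorem exists_combination_eq_one {x₁ x₂ x₃ x₄ : R}
    (h : ∀ (K : Type u) [Field K] (π : R →+* K),
      π x₁ = 0 → π x₂ = 0 → π x₃ = 0 → π x₄ ≠ 0) :
    ∃ α β γ δ : R, α * x₁ + β * x₂ + γ * x₃ + δ * x₄ = 1 := by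
  by_contra hne
  have hI : Ideal.span {x₁, x₂, x₃, x₄} ≠ ⊤ := by
    intro htop
    have h₁ : (1 : R) ∈ Ideal.span {x₁, x₂, x₃, x₄} := htop ▸ Submodule.mem_top
    simp only [Ideal.mem_span_insert, Ideal.mem_span_singleton'] at h₁
    obtain ⟨α, _, ⟨β, _, ⟨γ, _, ⟨δ, rfl⟩, rfl⟩, rfl⟩, h₁⟩ := h₁
    exact hne ⟨α, β, γ, δ, by linear_combination -h₁⟩
  obtain ⟨M, hM, hle⟩ := Ideal.exists_le_maximal _ hI
  let := Ideal.Quotient.field M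
  have hmem : ∀ x ∈ ({x₁, x₂, x₃, x₄} : Set R), Ideal.Quotient.mk M x = 0 := fun x hx =>
    Ideal.Quotient.eq_zero_iff_mem.mpr (hle (Ideal.subset_span hx))
  exact h (R ⧸ M) (Ideal.Quotient.mk M) (hmem _ (by simp)) (hmem _ (by simp)) (hmem _ (by simp))
    (hmem _ (by simp))

theorem mk_eq_mk_iff_dvd_sub {c x y : R} :
    Ideal.Quotient.mk (Ideal.span {c}) x = Ideal.Quotient.mk (Ideal.span {c}) y ↔ c ∣ x - y := by
  rw [Ideal.Quotient.eq, Ideal.mem_span_singleton]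

theorem exists_eq_mk_of_units {c : R} (x : (R ⧸ Ideal.span {c})ˣ) :
    ∃ y y' : R, Ideal.Quotient.mk (Ideal.span {c}) y = x ∧ c ∣ y * y' - 1 := by
  obtain ⟨y, hy⟩ := Ideal.Quotient.mk_surjective (x : R ⧸ Ideal.span {c})
  obtain ⟨y', hy'⟩ := Ideal.Quotient.mk_surjective (x⁻¹ : (R ⧸ Ideal.span {c})ˣ).val
  exact ⟨y, y', hy, mk_eq_mk_iff_dvd_sub.mp (by rw [map_mul, hy, hy', map_one, Units.mul_inv])⟩

theorem exists_units_of_dvd {c y y' : R} (h : c ∣ y * y' - 1) :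
    ∃ x : (R ⧸ Ideal.span {c})ˣ, (x : R ⧸ Ideal.span {c}) = Ideal.Quotient.mk _ y := by
  have h₁ : Ideal.Quotient.mk (Ideal.span {c}) y * Ideal.Quotient.mk (Ideal.span {c}) y' = 1 := by
    rw [← map_mul, ← map_one (Ideal.Quotient.mk _)]
    exact mk_eq_mk_iff_dvd_sub.mpr h
  exact ⟨⟨_, _, h₁, by rw [mul_comm, h₁]⟩, rfl⟩

theorem coe_unitsReduction {a c y : R} {x : (R ⧸ Ideal.span {a * c})ˣ}
    (h : Ideal.Quotient.mk (Ideal.span {a * c}) y = x) :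
    (unitsReduction a c x : R ⧸ Ideal.span {c}) = Ideal.Quotient.mk _ y := by
  change Ideal.Quotient.factor _ (x : R ⧸ Ideal.span {a * c}) = _
  rw [← h, Ideal.Quotient.factor_mk]

/-- Membership in the image of `υ_{a,b,c}` in terms of elements of `R`. -/
theorem mem_range_upsilon_iff {a b c y : R} {x : (R ⧸ Ideal.span {c})ˣ}
    (h : Ideal.Quotient.mk (Ideal.span {c}) y = x) :
    x ∈ (upsilon a b c).range ↔
      ∃ s s' t t' : R, a * c ∣ s * s' - 1 ∧ b * c ∣ t * t' - 1 ∧ c ∣ y - s * t := by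
  constructor
  · rintro ⟨⟨u, v⟩, rfl⟩
    obtain ⟨s, s', hs, hss⟩ := exists_eq_mk_of_units u
    obtain ⟨t, t', ht, htt⟩ := exists_eq_mk_of_units v
    refine ⟨s, s', t, t', hss, htt, mk_eq_mk_iff_dvd_sub.mp ?_⟩
    rw [h, map_mul, ← coe_unitsReduction hs, ← coe_unitsReduction ht]
    rfl
  · rintro ⟨s, s', t, t', hs, ht, hst⟩
    obtain ⟨u, hu⟩ := exists_units_of_dvd hs
    obtain ⟨v, hv⟩ := exists_units_of_dvd ht
    refine ⟨(u, v), Units.ext ?_⟩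
    rw [← h, mk_eq_mk_iff_dvd_sub.mpr hst, map_mul, ← coe_unitsReduction hu.symm,
      ← coe_unitsReduction hv.symm]
    rfl

/-- Over an elementary divisor ring each unit modulo `c` is a product of a unit modulo `ac` and a
unit modulo `bc`, if `a` and `b` are coprime. -/
theorem IsEDR.exists_factorization (hR : IsEDR R) {a b c x y : R} (hab : IsCoprime a b)
    (hxy : c ∣ x * y - 1) :
    ∃ s s' t t' : R, a * c ∣ s * s' - 1 ∧ b * c ∣ t * t' - 1 ∧ c ∣ x - s * t := by
  obtain ⟨m, n, hmn⟩ := hab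
  obtain ⟨z, hz⟩ := hxy
  let w := 1 - x * y
  have hw : w = -(c * z) := by simp only [w]; linear_combination -hz
  let e := m * a
  -- This is `(1 - e) • E + e • F`, with `E = diag(1, 0)` and `F` the product of the column `(x, w)`
  -- and the row `(y * (1 + w), w)`, a projection of rank one. Here `e` is `0` modulo `a` and `1`
  -- modulo `b`, and `w` is `0` modulo `c`.
  let A : Matrix (Fin 2) (Fin 2) R := !![1 - e * w ^ 2, e * x * w; e * w * y * (1 + w), e * w ^ 2]
  obtain ⟨M, N, D, hD, hoff, hdvd⟩ := hR 2 2 two_pos two_pos A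
  let P := M⁻¹.val
  let Q := N⁻¹.val
  have hA : A = P * D * Q := by
    have hM : P * M.val = 1 := by rw [← Units.val_mul]; simp
    have hN : N.val * Q = 1 := by rw [← Units.val_mul]; simp
    rw [← hD, ← Matrix.mul_assoc, ← Matrix.mul_assoc, hM, Matrix.one_mul, Matrix.mul_assoc, hN,
      Matrix.mul_one]
  have h₀₁ : D 0 1 = 0 := hoff 0 1 (by simp)
  have h₁₀ : D 1 0 = 0 := hoff 1 0 (by simp)
  have hgh : D 0 0 ∣ D 1 1 := hdvd 0 (by simp) (by simp)
  set g := D 0 0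
  set h := D 1 1
  have hent : ∀ i j, A i j = P i 0 * g * Q 0 j + P i 1 * h * Q 1 j := by
    intro i j
    rw [hA]
    simp [Matrix.mul_apply, Fin.sum_univ_two, h₀₁, h₁₀, g, h]
  have hdet : M.val.det * A.det * N.val.det = g * h := by
    rw [← Matrix.det_mul, ← Matrix.det_mul, hD, Matrix.det_fin_two, h₀₁]
    simp [g, h]
  have hdetA : A.det = e * w ^ 2 * (n * b) := by
    simp only [A, Matrix.det_fin_two_of, w, e]
    linear_combination (-(m * a * (1 - x * y) ^ 2)) * hmn
  have e₀₀ : 1 - e * w ^ 2 = _ := hent 0 0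
  have e₀₁ : e * x * w = _ := hent 0 1
  have e₁₀ : e * w * y * (1 + w) = _ := hent 1 0
  have e₁₁ : e * w ^ 2 = _ := hent 1 1
  obtain ⟨k, hk⟩ := hgh
  -- The trace of `A` is `1` and `g` divides every entry.
  obtain ⟨g', hg⟩ : ∃ g', g * g' = 1 := by
    refine ⟨P 0 0 * Q 0 0 + P 1 0 * Q 0 1 + k * (P 0 1 * Q 1 0 + P 1 1 * Q 1 1), ?_⟩
    linear_combination (-(P 0 1 * Q 1 0 + P 1 1 * Q 1 1)) * hk - e₀₀ - e₁₁
  obtain ⟨l, hl⟩ : ∃ l, h = a * b * c * l := by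
    refine ⟨g' * (M.val.det * (m * c * z ^ 2 * n) * N.val.det), ?_⟩
    rw [hdetA, hw] at hdet
    simp only [e] at hdet
    linear_combination (-h) * hg - g' * hdet
  -- Modulo `abc`, `A` is the column `g • P · 0` times the row `Q 0 ·`. So `s * s'` is congruent to
  -- the corner of `A`, `t' * t` to the value of `A` at the row and column defining `F`, and `s * t`
  -- to the first entry of `A *ᵥ ![x, w]`, which is `x`.
  refine ⟨g * P 0 0, Q 0 0, Q 0 0 * x + Q 0 1 * w,
    g * (y * (1 + w) * P 0 0 + w * P 1 0), ?_, ?_, ?_⟩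
  · refine ⟨-(m * c * z ^ 2 + b * l * P 0 1 * Q 1 0), ?_⟩
    rw [hl] at e₀₀
    simp only [hw, e] at e₀₀
    linear_combination -e₀₀
  · refine ⟨-(n * c * z ^ 2 + a * l * (y * (1 + w) * P 0 1 + w * P 1 1) *
      (Q 1 0 * x + Q 1 1 * w)), ?_⟩
    have hwb : w ^ 2 = c ^ 2 * z ^ 2 := by rw [hw]; ring
    have hxy' : x * y = 1 - w := by simp [w]
    rw [hl] at e₀₀ e₀₁ e₁₀ e₁₁
    have he : e = 1 - n * b := by simp only [e]; linear_combination hmn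
    linear_combination (-(y * (1 + w) * x)) * e₀₀ - (y * (1 + w) * w) * e₀₁ - (w * x) * e₁₀
      - w ^ 2 * e₁₁ - (n * b) * hwb + w ^ 2 * he + (1 + w) * (1 + e * w ^ 2) * hxy'
  · refine ⟨a * b * l * P 0 1 * (Q 1 0 * x + Q 1 1 * w), ?_⟩
    rw [hl] at e₀₀ e₀₁
    linear_combination x * e₀₀ + w * e₀₁

/-- The factorization is available for every unit, not only for squares. -/
theorem IsEDR.isBooleanGroup_cokerUpsilon (hR : IsEDR R) {a b c : R} (hab : IsCoprime a b) :
    IsBooleanGroup (CokerUpsilon a b c) := by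
  intro x
  obtain ⟨x, rfl⟩ := QuotientGroup.mk_surjective x
  rw [← QuotientGroup.mk_pow, QuotientGroup.eq_one_iff]
  obtain ⟨y, y', hy, hyy⟩ := exists_eq_mk_of_units (x ^ 2)
  exact (mem_range_upsilon_iff hy).mpr (hR.exists_factorization hab hyy)

theorem exists_factorization_sq_of_isBooleanGroup {a b c y y' : R}
    (h : IsBooleanGroup (CokerUpsilon a b c)) (hy : c ∣ y * y' - 1) :
    ∃ s s' t t' : R, a * c ∣ s * s' - 1 ∧ b * c ∣ t * t' - 1 ∧ c ∣ y ^ 2 - s * t := by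
  obtain ⟨x, hx⟩ := exists_units_of_dvd hy
  refine (mem_range_upsilon_iff (x := x ^ 2) (by simp [hx])).mp ?_
  rw [← QuotientGroup.eq_one_iff, QuotientGroup.mk_pow]
  exact h x

/-! ### From factored squares to elementary divisors -/

/-- If the square of `β` modulo `c` factors into a unit modulo `ac` and a unit modulo `bc`, then the
matrix with rows `(ca, β)` and `(0, cb)` maps some vector to one that is unimodular modulo the
determinant. -/
theorem exists_unimodular_image_of_factorization {a b c β β' z u u' v v' : R}
    (hfree : SelfDualRankOneTwoGeneratedFree (R ⧸ Ideal.span {(c * a) * (c * b)}))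
    (hab : IsCoprime a b) (hβ : β * β' + c * z = 1) (hu : a * c ∣ u * u' - 1)
    (hv : b * c ∣ v * v' - 1) (huv : c ∣ β ^ 2 - u * v) :
    ∃ y₁ y₂ s t w : R, s * (c * a * y₁ + β * y₂) + t * (0 * y₁ + c * b * y₂) +
      w * (c * a * (c * b) - β * 0) = 1 := by
  obtain ⟨m, n, hmn⟩ := hab
  obtain ⟨i, hi⟩ := hu
  obtain ⟨j, hj⟩ := hv
  obtain ⟨k, hk⟩ := huv
  -- The symmetric matrix is the sum of the squares of the linear forms `(c * a * β', 1)` and `(c *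
  -- a, β)`, with weights `n * b * u` and `m * a * v'`. The two forms have determinant `c * a * (β *
  -- β' - 1)`, a multiple of `c ^ 2 * a`.
  let p := n * b * u * (c * a * β') ^ 2 + m * a * v' * (c * a) ^ 2
  let q := n * b * u * (c * a * β') + m * a * v' * (c * a * β)
  let r := n * b * u + m * a * v' * β ^ 2
  have hdet : (c * a) * (c * b) ∣ p * r - q * q := by
    refine ⟨m * n * u * v' * (c * a * z) ^ 2, ?_⟩
    simp only [p, q, r]
    linear_combination m * n * a * b * u * v' * (c * a) ^ 2 * (β * β' - 1 - c * z) * hβ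
  obtain ⟨α₁, α₂, α₃, α₄, hα⟩ : ∃ α₁ α₂ α₃ α₄ : R,
      α₁ * p + α₂ * q + α₃ * r + α₄ * ((c * a) * (c * b)) = 1 := by
    -- At a zero of `c`, `u = v' * β ^ 2` and `r = u`; at a zero of `a`, again `r = u`; at the
    -- remaining zeros of `d`, `b = 0` and `p = v' * (c * a) ^ 2`. None of these values vanishes.
    refine exists_combination_eq_one fun K _ π hp _ hr hd => ?_
    have hmn := congrArg π hmn
    have hi := congrArg π hi
    have hj := congrArg π hj
    have hk := congrArg π hk
    have hβ := congrArg π hβ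
    simp only [p, r, map_add, map_mul, map_sub, map_pow, map_one] at hp hr hd hmn hi hj hk hβ
    by_cases hc : π c = 0
    · simp only [hc, mul_zero, zero_mul] at hi hj hk
      refine one_ne_zero (α := K) ?_
      linear_combination -hi + π u' * hr - π u' * π u * hmn - π u' * (π m * π a * π v') * hk
        - π u' * (π m * π a * π u) * hj
    by_cases ha : π a = 0
    · simp only [ha, mul_zero, zero_mul] at hi hr hmn
      refine one_ne_zero (α := K) ?_
      linear_combination -hi + π u' * hr - π u' * π u * hmn
    have hb : π b = 0 := by simpa [hc, ha] using hd
    simp only [hb, mul_zero, zero_mul] at hj hp hmn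
    refine hc (pow_eq_zero_iff two_ne_zero |>.mp ((mul_eq_zero.mp
      (?_ : π a ^ 2 * π c ^ 2 = 0)).resolve_left (pow_ne_zero 2 ha)))
    linear_combination π v * hp - π v * π v' * π a ^ 2 * π c ^ 2 * hmn - π a ^ 2 * π c ^ 2 * hj
  obtain ⟨y₁, y₂, s, t, w, hy⟩ := exists_unimodular_image_of_symmetric hfree hdet hα
  obtain ⟨s', t', w', _, h⟩ : ∃ s t w x : R, s * (c * a * y₁ + β * y₂) + t * (c * b * y₂) +
      w * ((c * a) * (c * b)) + x * 0 = 1 := by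
    refine exists_combination_eq_one fun K _ π h₁ h₂ hd _ => ?_
    have hmn := congrArg π hmn
    have hβ := congrArg π hβ
    have hy := congrArg π hy
    simp only [map_add, map_mul, map_one] at h₁ h₂ hd hmn hβ hy
    -- If `c * a` vanishes, then so do `p`, `q` and, by the triangular system, `y₂`. Otherwise `b`
    -- vanishes and the symmetric matrix is a multiple of the square of the first row `(c * a, β)`.
    have hB : π p * π y₁ + π q * π y₂ = 0 ∧ π q * π y₁ + π r * π y₂ = 0 := by
      simp only [p, q, r, map_add, map_mul, map_pow]
      by_cases hca : π c * π a = 0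
      · have hy₂ : π y₂ = 0 := by
          by_cases hc : π c = 0
          · rw [hc] at h₁ hβ
            linear_combination π β' * h₁ - π y₂ * hβ
          · have ha : π a = 0 := by simpa [hc] using hca
            have hb : π b ≠ 0 := by
              intro hb
              simp [ha, hb] at hmn
            simpa [hc, hb] using h₂
        simp [hca, hy₂]
      · have hb : π b = 0 := by
          have : π c ≠ 0 := left_ne_zero_of_mul hca
          simpa [hca, this] using hd
        simp only [hb]
        constructor
        · linear_combination π m * π a * π v' * (π c * π a) * h₁
        · linear_combination π m * π a * π v' * π β * h₁
    rw [hB.1, hB.2, hd] at hy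
    simp at hy
  exact ⟨y₁, y₂, s', t', w', by linear_combination h⟩

/-- Each unimodular matrix over a Hermite ring represents `1` if the unimodular upper triangular
ones do. -/
theorem IsHermite.unimodularMatricesRepresentOne (hR : IsHermite R)
    (h : ∀ a b e α β γ : R, α * a + β * b + γ * e = 1 →
      ∃ x₁ x₂ y₁ y₂ : R, x₁ * (a * y₁ + b * y₂) + x₂ * (0 * y₁ + e * y₂) = 1) :
    UnimodularMatricesRepresentOne R := by
  intro a b c e α β γ δ h₁
  obtain ⟨g, k, l, ⟨s, t, hst⟩, rfl, rfl⟩ := hR c e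
  -- The column operation with columns `(l, -k)` and `(s, t)`, of determinant `1`, turns the lower
  -- row `g • (k, l)` into `(0, g)`.
  obtain ⟨x₁, x₂, y₁, y₂, hxy⟩ := h (a * l - b * k) (a * s + b * t) g (α * t - β * s)
    (α * k + β * l) (γ * k + δ * l) (by linear_combination h₁ + (α * a + β * b) * hst)
  exact ⟨x₁, x₂, l * y₁ + s * y₂, -k * y₁ + t * y₂,
    by linear_combination hxy + x₂ * g * y₂ * hst⟩

theorem IsHermite.isEDR_of_isBooleanGroup (hR : IsHermite R)
    (hfree : ∀ a : R, SelfDualRankOneTwoGeneratedFree (R ⧸ Ideal.span {a}))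
    (hB : ∀ a b c : R, IsCoprime a b → IsBooleanGroup (CokerUpsilon a b c)) : IsEDR R := by
  refine hR.isEDR (hR.unimodularMatricesRepresentOne ?_)
  intro α β γ k₁ k₂ k₃ hk
  obtain ⟨c, a, b, hab, rfl, rfl⟩ := hR α γ
  have hβ : β * k₂ + c * (k₁ * a + k₃ * b) = 1 := by linear_combination hk
  obtain ⟨u, u', v, v', hu, hv, huv⟩ := exists_factorization_sq_of_isBooleanGroup
    (y := β) (y' := k₂) (hB a b c hab) ⟨-(k₁ * a + k₃ * b), by linear_combination hβ⟩
  obtain ⟨y₁, y₂, s, t, w, h⟩ :=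
    exists_unimodular_image_of_factorization (hfree _) hab hβ hu hv huv
  exact hR.exists_value_eq_one h

/-! ### Rings with the `(WSU)₂` property -/

theorem IsUnimodular.exists_combination_eq_one {A : Matrix (Fin 2) (Fin 2) R}
    (hA : IsUnimodular A) :
    ∃ α β γ δ : R, α * A 0 0 + β * A 0 1 + γ * A 1 0 + δ * A 1 1 = 1 := by
  have h₁ : (1 : R) ∈ Ideal.span (Set.range fun p : Fin 2 × Fin 2 => A p.1 p.2) := by
    rw [hA]; exact Submodule.mem_top
  obtain ⟨c, hc⟩ := (Ideal.mem_span_range_iff_exists_fun).mp h₁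
  refine ⟨c (0, 0), c (0, 1), c (1, 0), c (1, 1), ?_⟩
  rw [Fintype.sum_prod_type] at hc
  simpa [Fin.sum_univ_two, add_assoc] using hc

theorem isUnimodular_of_combination_eq_one {a b c e α β γ δ : R}
    (h : α * a + β * b + γ * c + δ * e = 1) : IsUnimodular !![a, b; c, e] := by
  refine (Ideal.eq_top_iff_one _).mpr (Ideal.mem_span_range_iff_exists_fun.mpr
    ⟨fun p => !![α, β; γ, δ] p.1 p.2, ?_⟩)
  rw [Fintype.sum_prod_type]
  simpa [Fin.sum_univ_two, add_assoc] using h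

theorem IsUnimodular.mul_GL {A : Matrix (Fin 2) (Fin 2) R} (hA : IsUnimodular A)
    (N : GL (Fin 2) R) : IsUnimodular (A * N.val) := by
  have hAN : A = A * N.val * N⁻¹.val := by
    have : N.val * N⁻¹.val = 1 := by rw [← Units.val_mul]; simp
    rw [Matrix.mul_assoc, this, Matrix.mul_one]
  refine top_le_iff.mp (hA.symm.le.trans (Ideal.span_le.mpr ?_))
  rintro _ ⟨⟨i, j⟩, rfl⟩
  change A i j ∈ _
  rw [congrFun (congrFun hAN i) j, Matrix.mul_apply]
  exact Ideal.sum_mem _ fun k _ =>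
    Ideal.mul_mem_right _ _ (Ideal.subset_span ⟨(i, k), rfl⟩)

theorem IsHermite.isEDR_of_isWSU_two (hR : IsHermite R)
    (hfree : ∀ a : R, SelfDualRankOneTwoGeneratedFree (R ⧸ Ideal.span {a}))
    (hW : IsWSU 2 R) : IsEDR R := by
  refine hR.isEDR fun a b c e α β γ δ h => ?_
  have hA := isUnimodular_of_combination_eq_one h
  obtain ⟨N, hN⟩ := hW _ hA
  obtain ⟨k₁, k₂, k₃, k₄, hk⟩ := (hA.mul_GL N).exists_combination_eq_one
  set B := !![a, b; c, e] * N.val with hB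
  have hsymm : B 1 0 = B 0 1 := hN.apply 0 1
  obtain ⟨y₁, y₂, s, t, w, hy⟩ := exists_unimodular_image_of_symmetric
    (d := B 0 0 * B 1 1 - B 0 1 * B 1 0) (hfree _) (p := B 0 0) (q := B 0 1) (r := B 1 1)
    (α := k₁) (β := k₂ + k₃) (γ := k₄) (δ := 0) (by rw [hsymm])
    (by rw [hsymm] at hk; linear_combination hk)
  obtain ⟨x₁, x₂, z₁, z₂, hx⟩ := hR.exists_value_eq_one (a := B 0 0) (b := B 0 1) (c := B 1 0)
    (e := B 1 1) (y₁ := y₁) (y₂ := y₂) (s := s) (t := t) (w := w)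
    (by linear_combination hy + t * y₁ * hsymm)
  -- A value of the symmetric `B = A * N` at `(x, z)` is the value of `A` at `(x, N *ᵥ z)`.
  refine ⟨x₁, x₂, N.val 0 0 * z₁ + N.val 0 1 * z₂, N.val 1 0 * z₁ + N.val 1 1 * z₂, ?_⟩
  simp only [hB, Matrix.mul_apply, Fin.sum_univ_two] at hx
  simp at hx
  linear_combination hx

end

end HermiteRings

theorem corollaryC7 {R : Type*} [CommRing R]
    (hR : HermiteRings.IsHermite R)
    (hfree : ∀ a : R, HermiteRings.SelfDualRankOneTwoGeneratedFree (R ⧸ Ideal.span {a})) :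
    (HermiteRings.IsEDR R ↔
      ∀ a b c : R, IsCoprime a b →
        HermiteRings.IsBooleanGroup (HermiteRings.CokerUpsilon a b c)) ∧
    (HermiteRings.IsWSU 2 R → HermiteRings.IsEDR R) :=
  ⟨⟨fun h _ _ _ hab => h.isBooleanGroup_cokerUpsilon hab, hR.isEDR_of_isBooleanGroup hfree⟩,
    hR.isEDR_of_isWSU_two hfree⟩
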